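/- Let $\mathbf X=(X_0,\dots,X_T)$ be an $\mathbb R^m$-valued process, realised as the coordinate process on the path space $\mathcal X=(\mathbb R^m)^{T+1}$ with law $P$ (for instance a Markov process), and let $\mu_s$ be the law of $X_s$. Let $f=(f_0,\dots,f_T)$ be a payoff with $f_s\ge 0$ and $f_s\in L_1(\mu_s)$. For $h=(h_0,\dots,h_T)$ put $\theta_{f,s}(h)(x_s)=1_{\{f_s(x_s)\ge h_s(x_s)\}}$, $\theta^-_{f,s}(h)=1-\theta_{f,s}(h)$, and define the cash flow function $$\vartheta_{t:w}(f,h)(\mathbf x)=\sum_{s=t}^{t+w} f_s(x_s)\,\theta_{f,s}(h)(x_s)\prod_{r=t}^{s-1}\theta^-_{f,r}(h)(x_r)+h_{t+w}(x_{t+w})\prod_{r=t}^{t+w}\theta^-_{f,r}(h)(x_r),\qquad \mathbf x=(x_0,\dots,x_T)\in\mathcal X .$$ For each $s\in\{0,\dots,T\}$ let $\mathcal H_s$ be a set of functions $\mathbb R^m\to\mathbb R$ that is a closed convex subset of $L_2(\mu_s)$, and let $\mathcal H=\{h=(h_0,\dots,h_T)\mid h_s\in\mathcal H_s \text{ for all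 } s,\ h_T=f_T\}$. For $0\le t<T$ and $0\le w\le T-t-1$ let $$l_t(h)=|h_t-\vartheta_{t+1:w}(f,h)|^2-|\mathrm{pr}_{\mathcal H_t}\vartheta_{t+1:w}(f,h)-\vartheta_{t+1:w}(f,h)|^2,\qquad \mathcal L_t(\mathcal H)=\{l_t(h)\mid h\in\mathcal H\},$$ where $\mathrm{pr}_{\mathcal H_t}Y\in\mathcal H_t$ is the $L_2(\mu_t)$-projection of $E[Y\mid X_t=\cdot\,]$ onto $\mathcal H_t$ (if it has several versions in $\mathcal H_t$, the losses formed with all of them are included in $\mathcal L_t(\mathcal H)$). The VC-dimension $\mathrm{vc}(\mathcal G)$ of a class $\mathcal G$ of real functions on a set $S$ is the supremum of all $k$ for which there are $k$ distinct points $y_1,\dots,y_k\in S$ and $r\in\mathbb R^k$ such that for every $b\in\{0,1\}^k$ some $g\in\mathcal G$ satisfies $g(y_i)>r_i$ if $b_i=1$ and $g(y_i)\le r_i$ if $b_i=0$. For sample points $\mathbf x_1,\dots,\mathbf x_n\in\mathcal X$, $n\ge1$, put $d_{1,P_n}(g,g')=\frac1n\sum_{i=1}^n|g(\mathbf x_i)-g'(\mathbf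 x_i)|$, and let $N(\varepsilon,\mathcal U,d_{1,P_n})$ be the least number of closed $d_{1,P_n}$-balls of radius $\varepsilon$ (centred at arbitrary functions) that cover $\mathcal U$. Let $c(w)=2(w+2)\log_2(e(w+2))$. Assume that for all $s$, $|h_s|\le H$ for every $h_s\in\mathcal H_s$ and $\mathrm{vc}(\mathcal H_s)\le d<\infty$, and that $\vartheta_{t+1:w}(f,h)\le H$ for all $h\in\mathcal H$. Then for all $n\ge1$, all sample points $\mathbf x_1,\dots,\mathbf x_n\in\mathcal X$ and all $0<\varepsilon\le 64eH^2$, $$N(\varepsilon,\mathcal L_t(\mathcal H),d_{1,P_n})\le\begin{cases} e^4(d+1)^2(c(w)d+1)^2\left(\dfrac{64eH^2}{\varepsilon}\right)^{2d(c(w)+1)}, & w\ge1,\\[3mm] e^4(d+1)^4\left(\dfrac{64eH^2}{\varepsilon}\right)^{4d}, & w=0.\end{cases}$$ -/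

import Mathlib

open MeasureTheory ProbabilityTheory
open scoped ENNReal NNReal

namespace OptStop

noncomputable section

/-! ### Vapnik-Chervonenkis dimension of a class of real functions -/

/-- The class `G` of real functions on `S` shatters the finite set `σ`: there are levels `r` such
that every pattern `b` of `0`s and `1`s on `σ` is realised, `g x > r x` where `b x = 1` and
`g x ≤ r x` where `b x = 0`. -/
def Shatters {S : Type*} (G : Set (S → ℝ)) (σ : Finset S) : Prop :=
  ∃ r : S → ℝ, ∀ b : S → Bool, ∃ g ∈ G, ∀ x ∈ σ,
    (b x = true → r x < g x) ∧ (b x = false → g x ≤ r x)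

/-- The VC-dimension: the supremum of the cardinalities of the finite sets shattered by `G`. -/
def vcDim {S : Type*} (G : Set (S → ℝ)) : ℕ∞ :=
  ⨆ (σ : Finset S) (_ : Shatters G σ), (σ.card : ℕ∞)

/-! ### Empirical measure and empirical `L₁`-covering numbers -/

/-- `Pₙ g = (1/n) ∑ᵢ g(xᵢ)` for the sample points `x₁, …, xₙ`. -/
def empMean {S : Type*} {n : ℕ} (x : Fin n → S) (g : S → ℝ) : ℝ :=
  (1 / (n : ℝ)) * ∑ i, g (x i)

/-- The (pseudo)metric `d_{1,Pₙ}(g, g') = Pₙ |g - g'|` on real functions. -/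
abbrev empPseudoMetric {S : Type*} {n : ℕ} (x : Fin n → S) : PseudoMetricSpace (S → ℝ) where
  dist g g' := empMean x (fun y => |g y - g' y|)
  dist_self g := by simp [empMean]
  dist_comm g g' := by simp only [empMean, abs_sub_comm]
  dist_triangle g g' g'' := by
    simp only [empMean]
    rw [← mul_add, ← Finset.sum_add_distrib]
    refine mul_le_mul_of_nonneg_left (Finset.sum_le_sum fun i _ => ?_) (by positivity)
    exact abs_sub_le _ _ _

/-- `N(ε, U, d_{1,Pₙ})`: the minimal number of closed `d_{1,Pₙ}`-balls of radius `ε`, with arbitrary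
functions as centers, that cover `U`. -/
def empCoveringNumber {S : Type*} {n : ℕ} (x : Fin n → S) (ε : ℝ) (U : Set (S → ℝ)) : ℕ∞ :=
  @Metric.externalCoveringNumber (S → ℝ) (empPseudoMetric x).toPseudoEMetricSpace ε.toNNReal U

/-! ### Optimal stopping: path space, cash flow, centered loss -/

/-- The state space `ℝᵐ`. -/
abbrev State (m : ℕ) := EuclideanSpace ℝ (Fin m)

/-- The path space `ℝᵐ × … × ℝᵐ` (`T + 1` factors). -/
abbrev PathSpace (m T : ℕ) := Fin (T + 1) → State m

/-- The Heaviside function `1_{s ≥ 0}`. -/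
def heaviside (s : ℝ) : ℝ := if 0 ≤ s then 1 else 0

variable {m T : ℕ}

/-- `θ_{f,s}(h)(x_s)`: equal to `1` where the rule induced by `h` stops at time `s`. -/
def stopInd (f h : Fin (T + 1) → State m → ℝ) (s : Fin (T + 1)) (x : PathSpace m T) : ℝ :=
  heaviside (f s (x s) - h s (x s))

/-- `θ⁻_{f,s}(h)(x_s) = 1 - θ_{f,s}(h)(x_s)`. -/
def contInd (f h : Fin (T + 1) → State m → ℝ) (s : Fin (T + 1)) (x : PathSpace m T) : ℝ :=
  1 - stopInd f h s x

/-- The cash flow function `ϑ_{t:w}(f, h)` induced by `h`, for `t + w ≤ T`. -/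
def cashFlow (f h : Fin (T + 1) → State m → ℝ) (t w : ℕ) (htw : t + w ≤ T) (x : PathSpace m T) : ℝ :=
  let a : Fin (T + 1) := ⟨t, by omega⟩
  let b : Fin (T + 1) := ⟨t + w, by omega⟩
  (∑ s ∈ Finset.Icc a b, f s (x s) * stopInd f h s x * ∏ r ∈ Finset.Ico a s, contInd f h r x)
    + h b (x b) * ∏ r ∈ Finset.Icc a b, contInd f h r x

/-- The law `μ_t` of the coordinate `X_t` under the law `P` on path space. -/
def marginal (P : Measure (PathSpace m T)) (t : Fin (T + 1)) : Measure (State m) :=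
  P.map (fun x => x t)

/-- `E[Y | X_t = ·]`, through the regular conditional distribution of the path given `X_t`. -/
def condExpGiven (P : Measure (PathSpace m T)) [IsFiniteMeasure P] (t : Fin (T + 1))
    (Y : PathSpace m T → ℝ) (z : State m) : ℝ :=
  ∫ x, Y x ∂(condDistrib id (fun x : PathSpace m T => x t) P z)

/-- The subset of `L₂(μ)` formed by the classes of the functions in `C`. -/
def toL2 (μ : Measure (State m)) (C : Set (State m → ℝ)) : Set (Lp ℝ 2 μ) :=
  {g | ∃ h ∈ C, (g : State m → ℝ) =ᵐ[μ] h}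

/-- `p` is (a version in `C` of) the `L₂(μ)`-projection `π_C g` of `g` onto `C`. -/
def IsProj (μ : Measure (State m)) (C : Set (State m → ℝ)) (g p : State m → ℝ) : Prop :=
  p ∈ C ∧ ∀ q ∈ C, eLpNorm (p - g) 2 μ ≤ eLpNorm (q - g) 2 μ

/-- `ℋ = {h = (h_0, …, h_T) | h_s ∈ ℋ_s}`, with the terminal condition `h_T = f_T`. -/
def hypSpace (f : Fin (T + 1) → State m → ℝ) (𝓗 : Fin (T + 1) → Set (State m → ℝ)) :
    Set (Fin (T + 1) → State m → ℝ) :=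
  {h | (∀ s, h s ∈ 𝓗 s) ∧ h (Fin.last T) = f (Fin.last T)}

/-- The centered loss `|h_t - ϑ_{t+1:w}(f,h)|² - |p - ϑ_{t+1:w}(f,h)|²` as a function on path
space, where `p` stands for the projected cash flow `pr_{ℋ_t} ϑ_{t+1:w}(f,h)`. -/
def centeredLoss (f h : Fin (T + 1) → State m → ℝ) (t w : ℕ) (htw : t + 1 + w ≤ T)
    (p : State m → ℝ) (x : PathSpace m T) : ℝ :=
  let a : Fin (T + 1) := ⟨t, by omega⟩
  |h a (x a) - cashFlow f h (t + 1) w htw x| ^ 2 - |p (x a) - cashFlow f h (t + 1) w htw x| ^ 2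

/-- The centered loss class `𝓛_t(ℋ) = {l_t(h) | h ∈ ℋ}`. The projection
`pr_{ℋ_t} ϑ = π_{ℋ_t} E[ϑ | X_t = ·]` is determined up to `μ_t`-null sets only; the class holds the
centered losses formed with all its versions in `ℋ_t`. -/
def centeredLossClass (P : Measure (PathSpace m T)) [IsFiniteMeasure P]
    (f : Fin (T + 1) → State m → ℝ) (𝓗 : Fin (T + 1) → Set (State m → ℝ))
    (t w : ℕ) (htw : t + 1 + w ≤ T) : Set (PathSpace m T → ℝ) :=
  let a : Fin (T + 1) := ⟨t, by omega⟩
  {l | ∃ h ∈ hypSpace f 𝓗, ∃ p : State m → ℝ,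
    IsProj (marginal P a) (𝓗 a) (condExpGiven P a (cashFlow f h (t + 1) w htw)) p ∧
    l = centeredLoss f h t w htw p}

/-- `c(w) = 2 (w + 2) log₂(e (w + 2))`. -/
def cConst (w : ℕ) : ℝ := 2 * ((w : ℝ) + 2) * Real.logb 2 (Real.exp 1 * ((w : ℝ) + 2))

end

end OptStop

/-! By the covering–packing duality it suffices to bound the size `M` of a finite `ε`-separated
family of losses, each given by a pair `(h, p)` with `p` treated as one more function from `𝓗 a`.
The threshold indicators inside the cash flow are handled through subgraphs: whether a cash flow
exceeds a level is decided by `w + 1` threshold comparisons of components of `h`.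

A derandomised Haussler argument follows. If a pair of losses is `ε`-apart, integrating over levels
and averaging over pairs shows that some test of at most `w + 1` points separates a proportion `δ =
ε / (20 H²)` of any set of such pairs (`exists_separating_points`). Greedily, about `2 log M / δ`
tests separate all pairs (`exists_tests`). The `M` tuples then have distinct subgraph traces on a
set `F` of size about `(w + 1) 2 log M / δ`. Sauer–Shelah over the `w + 3` component functions gives
`M ≤ c⁻¹ ^ ((w + 3) d) * exp (c #F)` for every `c` in `(0, 1]` (`card_le_of_subgraphs_separated`).
Choosing `c` so that `c #F` is about `θ log M` lets this term be absorbed on the left. -/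

namespace OptStop

/-! ### Combinatorics: greedy separation and counting of subgraph traces. -/

open Finset in
/-- If every nonempty set of pairs from `Q` has a test separating a proportion `δ` of it, then `N`
tests leave at most a proportion `(1 - δ) ^ N` of `Q` unseparated. -/
theorem exists_tests {ι τ : Type*} (sep : τ → ι × ι → Prop) (Q : Finset (ι × ι)) {δ : ℝ}
    (hδ : δ ≤ 1)
    (h : ∀ Q' ⊆ Q, Q'.Nonempty → ∃ z, ∃ R ⊆ Q', (∀ q ∈ R, sep z q) ∧ δ * #Q' ≤ #R) (N : ℕ) :
    ∃ S : Finset τ, #S ≤ N ∧ ∃ R ⊆ Q, (∀ q ∈ Q, q ∉ R → ∃ z ∈ S, sep z q) ∧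
      (#R : ℝ) ≤ (1 - δ) ^ N * #Q := by
  classical
  induction N with
  | zero => exact ⟨∅, by simp, Q, subset_rfl, fun q hq hq' => absurd hq hq', by simp⟩
  | succ N ih =>
    obtain ⟨S, hS, R, hR, hsep, hcard⟩ := ih
    have hδ' : 0 ≤ 1 - δ := by linarith
    rcases R.eq_empty_or_nonempty with rfl | hne
    · exact ⟨S, by omega, ∅, hR, hsep, by simpa using by positivity⟩
    · obtain ⟨z, R', hR', hz, hc⟩ := h R hR hne
      refine ⟨insert z S, (card_insert_le _ _).trans (by omega), R \ R',
        sdiff_subset.trans hR, fun q hq hq' => ?_, ?_⟩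
      · by_cases hqR : q ∈ R
        · exact ⟨z, by simp, hz q (by simp_all)⟩
        · obtain ⟨y, hy, hy'⟩ := hsep q hq hqR
          exact ⟨y, by simp [hy], hy'⟩
      · rw [cast_card_sdiff hR', pow_succ]
        nlinarith

-- Chernoff-type count: the indicator of `#s ≤ D` is at most `c ^ (#s - D)`, and the sum of `c ^ #s`
-- over all subsets is `(1 + c) ^ #F`. Leaving `c` free allows it to be tuned to `log M` later.
open Finset in
theorem card_powerset_filter_le {α : Type*} (F : Finset α) (D : ℕ) {c : ℝ} (hc : 0 < c)
    (hc1 : c ≤ 1) :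
    (#{s ∈ F.powerset | #s ≤ D} : ℝ) ≤ c⁻¹ ^ D * Real.exp (c * #F) := by
  have h1 : (#{s ∈ F.powerset | #s ≤ D} : ℝ) ≤ ∑ s ∈ F.powerset, c⁻¹ ^ D * c ^ #s := by
    rw [card_filter]
    push_cast
    refine sum_le_sum fun s _ => ?_
    split_ifs with hs
    · rw [inv_pow, ← div_eq_inv_mul, one_le_div (by positivity)]
      exact pow_le_pow_of_le_one hc.le hc1 hs
    · positivity
  refine h1.trans ?_
  rw [← mul_sum]
  refine mul_le_mul_of_nonneg_left ?_ (by positivity)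
  have := sum_pow_mul_eq_add_pow c 1 F
  simp only [one_pow, mul_one] at this
  rw [this, mul_comm c, Real.exp_nat_mul]
  gcongr
  exact Real.add_one_le_exp c

open Finset in
/-- The Sauer-Shelah bound for the subgraphs of tuples of functions: a finite family of tuples whose
subgraphs have pairwise different traces on the finite set `F`. -/
theorem card_le_of_subgraphs_separated {ι κ S : Type*} (G : ι → κ → S → ℝ) (C : Finset ι)
    (F : Finset (κ × S × ℝ)) (J : Finset κ) (hJ : ∀ z ∈ F, z.1 ∈ J) (𝓒 : κ → Set (S → ℝ))
    (hG : ∀ i ∈ C, ∀ k, G i k ∈ 𝓒 k) (d : ℕ) (hvc : ∀ k, vcDim (𝓒 k) ≤ d)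
    (hsep : ∀ i ∈ C, ∀ i' ∈ C, i ≠ i' → ∃ z ∈ F,
      ¬ (z.2.2 < G i z.1 z.2.1 ↔ z.2.2 < G i' z.1 z.2.1))
    {c : ℝ} (hc : 0 < c) (hc1 : c ≤ 1) :
    (#C : ℝ) ≤ c⁻¹ ^ (#J * d) * Real.exp (c * #F) := by
  classical
  set tr : ι → Finset (κ × S × ℝ) := fun i => {z ∈ F | z.2.2 < G i z.1 z.2.1} with htr
  have hinj : Set.InjOn tr C := by
    intro i hi i' hi' hii
    by_contra hne
    obtain ⟨z, hz, hz'⟩ := hsep i hi i' hi' hne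
    have := congrArg (z ∈ ·) hii
    simp only [htr, mem_filter, hz, true_and, eq_iff_iff] at this
    exact hz' this
  have hcard : #C ≤ #{s ∈ F.powerset | #s ≤ #J * d} := by
    rw [← card_image_of_injOn hinj]
    -- Pajor's form of Sauer–Shelah: a family has at most as many members as it shatters sets. A
    -- shattered `s` is then split by component `k`, each fibre having at most `d` points.
    refine (card_le_card_shatterer _).trans (card_le_card fun s hs => ?_)
    rw [mem_shatterer] at hs
    have hsF : s ⊆ F := by
      obtain ⟨v, hv, hv'⟩ := hs subset_rfl
      obtain ⟨i, -, rfl⟩ := mem_image.1 hv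
      exact (inter_eq_left.1 hv').trans (filter_subset _ _)
    have key : ∀ t ⊆ s, ∃ i ∈ C, ∀ z ∈ s, (z.2.2 < G i z.1 z.2.1 ↔ z ∈ t) := by
      intro t ht
      obtain ⟨u, hu, hu'⟩ := hs ht
      obtain ⟨i, hi, rfl⟩ := mem_image.1 hu
      refine ⟨i, hi, fun z hz => ?_⟩
      have hzF : z ∈ F := hsF hz
      rw [← hu']
      simp [htr, hz, hzF]
    refine mem_filter.2 ⟨mem_powerset.2 hsF, ?_⟩
    rw [mul_comm]
    refine card_le_mul_card_image_of_maps_to (f := Prod.fst) (fun z hz => hJ z (hsF hz)) d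
      fun k _ => ?_
    set sk := {z ∈ s | z.1 = k} with hsk
    -- A shattered set carries only one level over each point: exceeding the higher level forces
    -- exceeding the lower one, so the pattern selecting only the higher is impossible.
    have hle : ∀ z ∈ sk, ∀ z' ∈ sk, z.2.1 = z'.2.1 → z'.2.2 ≤ z.2.2 := by
      intro z hz z' hz' h
      rw [hsk, mem_filter] at hz hz'
      by_contra! hlt
      obtain ⟨i, -, hi⟩ := key {z'} (by simpa using hz'.1)
      have h1 := (hi z' hz'.1).2 (by simp)
      have h2 := (hi z hz.1).1 (by
        rw [hz.2, h]; rw [hz'.2] at h1; exact hlt.trans h1)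
      rw [mem_singleton] at h2
      rw [h2] at hlt
      exact lt_irrefl _ hlt
    have hinj' : Set.InjOn (fun z : κ × S × ℝ => z.2.1) sk := by
      intro z hz z' hz' h
      have e1 := hle z hz z' hz' h
      have e2 := hle z' hz' z hz h.symm
      have hz1 := (mem_filter.1 hz).2
      have hz1' := (mem_filter.1 hz').2
      exact Prod.ext (hz1.trans hz1'.symm) (Prod.ext h (le_antisymm e2 e1))
    rw [← card_image_of_injOn hinj']
    have hsh : Shatters (𝓒 k) (sk.image fun z : κ × S × ℝ => z.2.1) := by
      have hr : ∃ r : S → ℝ, ∀ z ∈ sk, r z.2.1 = z.2.2 := by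
        refine ⟨fun y => if h : ∃ z ∈ sk, z.2.1 = y then h.choose.2.2 else 0, fun z hz => ?_⟩
        have h : ∃ z' ∈ sk, z'.2.1 = z.2.1 := ⟨z, hz, rfl⟩
        beta_reduce
        rw [dif_pos h, hinj' h.choose_spec.1 hz h.choose_spec.2]
      obtain ⟨r, hr⟩ := hr
      refine ⟨r, fun b => ?_⟩
      obtain ⟨i, hi, hi'⟩ := key {z ∈ s | b z.2.1 = true} (filter_subset _ _)
      refine ⟨G i k, hG i hi k, fun y hy => ?_⟩
      obtain ⟨z, hz, rfl⟩ := mem_image.1 hy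
      have hz1 := mem_filter.1 hz
      have := hi' z hz1.1
      rw [hz1.2, mem_filter] at this
      rw [hr z hz]
      refine ⟨fun hb => this.2 ⟨hz1.1, hb⟩, fun hb => ?_⟩
      by_contra! hlt
      rw [(this.1 hlt).2] at hb
      exact absurd hb (by simp)
    have := (le_iSup₂ (f := fun (σ : Finset S) (_ : Shatters (𝓒 k) σ) => (σ.card : ℕ∞)) _ hsh).trans
      (hvc k)
    exact_mod_cast this
  exact (Nat.cast_le.2 hcard).trans (card_powerset_filter_le F _ hc hc1)

/-! ### Distances as integrals over separating levels. -/

/-- If no level separates more than `c` of the pairs `(a q, b q)` of points of `[lo, hi]`, then the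
distances `|a q - b q|` add up to at most `c * (hi - lo)`. -/
theorem sum_abs_sub_le_of_separated_le {Q : Type*} (s : Finset Q) (a b : Q → ℝ) {lo hi c : ℝ}
    (hlh : lo ≤ hi) (ha : ∀ q ∈ s, a q ∈ Set.Icc lo hi) (hb : ∀ q ∈ s, b q ∈ Set.Icc lo hi)
    (h : ∀ u, ∀ R ⊆ s, (∀ q ∈ R, ¬ (u < a q ↔ u < b q)) → (R.card : ℝ) ≤ c) :
    ∑ q ∈ s, |a q - b q| ≤ c * (hi - lo) := by
  classical
  -- Layer cake: the levels `u` separating `a q` from `b q` form the interval `[min, max)`,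
  -- half-open because the comparisons `u < ·` are strict.
  have h1 : ∀ q ∈ s, |a q - b q| =
      ∫ u in lo..hi, (Set.Ico (min (a q) (b q)) (max (a q) (b q))).indicator 1 u := by
    intro q hq
    obtain ⟨ha1, ha2⟩ := ha q hq
    obtain ⟨hb1, hb2⟩ := hb q hq
    rw [intervalIntegral.integral_of_le hlh, ← integral_Ico_eq_integral_Ioc,
      integral_indicator_one measurableSet_Ico, measureReal_restrict_apply measurableSet_Ico,
      Set.inter_eq_left.2 (Set.Ico_subset_Ico (le_min ha1 hb1) (max_le ha2 hb2)),
      Real.volume_real_Ico_of_le min_le_max, max_sub_min_eq_abs']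
  rw [Finset.sum_congr rfl h1]
  have hint : ∀ q ∈ s, IntervalIntegrable
      ((Set.Ico (min (a q) (b q)) (max (a q) (b q))).indicator (1 : ℝ → ℝ)) volume lo hi := by
    intro q _
    rw [intervalIntegrable_iff_integrableOn_Icc_of_le hlh]
    exact (integrable_const (1 : ℝ)).indicator measurableSet_Ico
  rw [← intervalIntegral.integral_finsetSum hint]
  rw [mul_comm, ← smul_eq_mul, ← intervalIntegral.integral_const]
  refine intervalIntegral.integral_mono_on hlh
    (by simpa only [Finset.sum_fn] using IntervalIntegrable.sum s hint) (by simp) fun u _ => ?_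
  refine le_trans (le_of_eq ?_) (h u {q ∈ s | ¬ (u < a q ↔ u < b q)} (Finset.filter_subset _ _)
    (by simp))
  rw [Finset.card_filter]
  push_cast
  refine Finset.sum_congr rfl fun q _ => ?_
  simp only [Set.indicator_apply, Set.mem_Ico, inf_le_iff, lt_sup_iff, Pi.one_apply]
  refine if_congr ?_ rfl rfl
  simp only [← not_lt]
  tauto

/-! ### Cash flows and centered losses. -/

variable {m T : ℕ}

theorem stopInd_of_le {f h : Fin (T + 1) → State m → ℝ} {s : Fin (T + 1)} {x : PathSpace m T}
    (hs : h s (x s) ≤ f s (x s)) : stopInd f h s x = 1 := by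
  simp [stopInd, heaviside, hs]

theorem stopInd_of_lt {f h : Fin (T + 1) → State m → ℝ} {s : Fin (T + 1)} {x : PathSpace m T}
    (hs : f s (x s) < h s (x s)) : stopInd f h s x = 0 := by
  simp [stopInd, heaviside, hs]

/-- The cash flow is the payoff at the first stopping time before `t + w`, and `max f h` at time
`t + w` if there is none. -/
theorem cashFlow_cases (f h : Fin (T + 1) → State m → ℝ) (t w : ℕ) (htw : t + w ≤ T)
    (a b : Fin (T + 1)) (ha : (a : ℕ) = t) (hb : (b : ℕ) = t + w) (x : PathSpace m T) :
    (∃ s ∈ Finset.Ico a b, h s (x s) ≤ f s (x s) ∧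
      (∀ r ∈ Finset.Ico a s, f r (x r) < h r (x r)) ∧ cashFlow f h t w htw x = f s (x s)) ∨
    ((∀ r ∈ Finset.Ico a b, f r (x r) < h r (x r)) ∧
      cashFlow f h t w htw x = max (f b (x b)) (h b (x b))) := by
  classical
  have hcf : cashFlow f h t w htw x =
      (∑ s ∈ Finset.Icc a b, f s (x s) * stopInd f h s x * ∏ r ∈ Finset.Ico a s, contInd f h r x)
        + h b (x b) * ∏ r ∈ Finset.Icc a b, contInd f h r x := by
    have ha' : (⟨t, by omega⟩ : Fin (T + 1)) = a := Fin.ext ha.symm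
    have hb' : (⟨t + w, by omega⟩ : Fin (T + 1)) = b := Fin.ext hb.symm
    simp only [cashFlow, ha', hb']
  have hab : a ≤ b := Fin.le_def.2 (by omega)
  by_cases hst : ∃ s, s ∈ Finset.Icc a b ∧ h s (x s) ≤ f s (x s)
  · obtain ⟨s, ⟨hs, hsf⟩, hmin⟩ := WellFounded.has_min (wellFounded_lt (α := Fin (T + 1)))
      {s | s ∈ Finset.Icc a b ∧ h s (x s) ≤ f s (x s)} hst
    have hs' := Finset.mem_Icc.1 hs
    have hlt : ∀ r ∈ Finset.Ico a s, f r (x r) < h r (x r) := by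
      intro r hr
      rw [Finset.mem_Ico] at hr
      by_contra! hle
      exact hmin r ⟨Finset.mem_Icc.2 ⟨hr.1, hr.2.le.trans hs'.2⟩, hle⟩ hr.2
    have hcs : contInd f h s x = 0 := by rw [contInd, stopInd_of_le hsf, sub_self]
    have hval : cashFlow f h t w htw x = f s (x s) := by
      rw [hcf, Finset.prod_eq_zero hs hcs, mul_zero, add_zero, Finset.sum_eq_single_of_mem s hs,
        stopInd_of_le hsf, Finset.prod_eq_one, mul_one, mul_one]
      · intro r hr
        rw [contInd, stopInd_of_lt (hlt r hr), sub_zero]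
      · intro r hr hrs
        rcases lt_or_gt_of_ne hrs with hlt' | hgt
        · rw [stopInd_of_lt (hlt r (Finset.mem_Ico.2 ⟨(Finset.mem_Icc.1 hr).1, hlt'⟩))]
          simp
        · rw [Finset.prod_eq_zero (Finset.mem_Ico.2 ⟨hs'.1, hgt⟩) hcs, mul_zero]
    -- Stopping exactly at `b` goes into the second alternative, where the payoff is the maximum; no
    -- threshold test is then needed at `b`.
    rcases hs'.2.lt_or_eq with hsb | rfl
    · exact Or.inl ⟨s, Finset.mem_Ico.2 ⟨hs'.1, hsb⟩, hsf, hlt, hval⟩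
    · exact Or.inr ⟨hlt, by rw [hval, max_eq_left hsf]⟩
  · push Not at hst
    refine Or.inr ⟨fun r hr => hst r (Finset.Ico_subset_Icc_self hr), ?_⟩
    rw [hcf, Finset.sum_eq_zero, Finset.prod_eq_one, zero_add, mul_one, max_eq_right]
    · exact (hst b (Finset.right_mem_Icc.2 hab)).le
    · intro r hr
      rw [contInd, stopInd_of_lt (hst r hr), sub_zero]
    · intro r hr
      rw [stopInd_of_lt (hst r hr)]
      simp

theorem cashFlow_nonneg {f h : Fin (T + 1) → State m → ℝ} (hf : ∀ s z, 0 ≤ f s z) (t w : ℕ)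
    (htw : t + w ≤ T) (x : PathSpace m T) : 0 ≤ cashFlow f h t w htw x := by
  rcases cashFlow_cases f h t w htw ⟨t, by omega⟩ ⟨t + w, by omega⟩ rfl rfl x with
    ⟨s, -, -, -, e⟩ | ⟨-, e⟩ <;> rw [e]
  · exact hf _ _
  · exact le_max_of_le_left (hf _ _)

/-- The comparison of a cash flow with a level is determined by the comparisons of `h` with `f`
before the last time and of `h` with the level at the last time. -/
theorem lt_cashFlow_congr {f h h' : Fin (T + 1) → State m → ℝ} {t w : ℕ} {htw : t + w ≤ T}
    {a b : Fin (T + 1)} (ha : (a : ℕ) = t) (hb : (b : ℕ) = t + w) {x : PathSpace m T} {u : ℝ}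
    (hs : ∀ s ∈ Finset.Ico a b, (f s (x s) < h s (x s) ↔ f s (x s) < h' s (x s)))
    (hu : u < h b (x b) ↔ u < h' b (x b)) :
    u < cashFlow f h t w htw x ↔ u < cashFlow f h' t w htw x := by
  rcases cashFlow_cases f h t w htw a b ha hb x with ⟨s, hsm, hsf, hlt, e⟩ | ⟨hlt, e⟩ <;>
  rcases cashFlow_cases f h' t w htw a b ha hb x with ⟨s', hsm', hsf', hlt', e'⟩ | ⟨hlt', e'⟩ <;>
  rw [e, e']
  · have hss : s = s' := by
      rw [Finset.mem_Ico] at hsm hsm'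
      rcases lt_trichotomy s s' with hl | hl | hl
      · have := hlt' s (Finset.mem_Ico.2 ⟨hsm.1, hl⟩)
        rw [← hs s (Finset.mem_Ico.2 hsm)] at this
        exact absurd this hsf.not_gt
      · exact hl
      · have := hlt s' (Finset.mem_Ico.2 ⟨hsm'.1, hl⟩)
        rw [hs s' (Finset.mem_Ico.2 hsm')] at this
        exact absurd this hsf'.not_gt
    rw [hss]
  · exact absurd ((hs s hsm).2 (hlt' s hsm)) hsf.not_gt
  · exact absurd ((hs s' hsm').1 (hlt s' hsm')) hsf'.not_gt
  · rw [lt_max_iff, lt_max_iff, hu]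

/-- The terms `v ^ 2` cancel in the centered loss, so its increment is a combination of the three
increments with coefficients of size at most `4 * H`. -/
theorem abs_centeredLoss_diff_le {H h h' p p' v v' : ℝ} (hh : |h| ≤ H) (hh' : |h'| ≤ H)
    (hp : |p| ≤ H) (hp' : |p'| ≤ H) (hv : 0 ≤ v) (hvH : v ≤ H) :
    |(|h - v| ^ 2 - |p - v| ^ 2) - (|h' - v'| ^ 2 - |p' - v'| ^ 2)| ≤
      4 * H * (|h - h'| + |p - p'| + |v - v'|) := by
  simp only [sq_abs]
  have e : (h - v) ^ 2 - (p - v) ^ 2 - ((h' - v') ^ 2 - (p' - v') ^ 2) =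
    (h + h' - 2 * v) * (h - h') + (2 * v - p - p') * (p - p') + 2 * (p' - h') * (v - v') := by ring
  rw [abs_le] at hh hh' hp hp'
  rw [e]
  refine (abs_add_three _ _ _).trans ?_
  simp only [abs_mul (h + h' - 2 * v), abs_mul (2 * v - p - p'), abs_mul (2 * (p' - h'))]
  have h1 : |h + h' - 2 * v| ≤ 4 * H := abs_le.2 ⟨by linarith, by linarith⟩
  have h2 : |2 * v - p - p'| ≤ 4 * H := abs_le.2 ⟨by linarith, by linarith⟩
  have h3 : |2 * (p' - h')| ≤ 4 * H := abs_le.2 ⟨by linarith, by linarith⟩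
  rw [mul_add, mul_add]
  gcongr

theorem abs_centeredLoss_le {H h p v : ℝ} (hh : |h| ≤ H) (hp : |p| ≤ H) (hv : 0 ≤ v)
    (hvH : v ≤ H) : |(|h - v| ^ 2 - |p - v| ^ 2)| ≤ 4 * H ^ 2 := by
  simp only [sq_abs]
  rw [abs_le] at hh hp
  rw [abs_le]
  constructor <;> nlinarith [sq_nonneg (h - v), sq_nonneg (p - v)]

theorem empMean_le {S : Type*} {n : ℕ} (hn : 0 < n) (x : Fin n → S) {g : S → ℝ} {c : ℝ}
    (h : ∀ y, g y ≤ c) : empMean x g ≤ c := by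
  have hn' : (0 : ℝ) < n := Nat.cast_pos.2 hn
  rw [empMean, one_div, inv_mul_le_iff₀ hn']
  refine (Finset.sum_le_sum fun i _ => h (x i)).trans ?_
  simp

/-! ### The packing bound. -/

/-- Among finitely many pairs of centered losses at empirical distance more than `ε`, a proportion
of at least `ε / (20 * H ^ 2)` is separated by a set of at most `w + 1` points in the subgraphs of
the underlying functions. -/
theorem exists_separating_points {f : Fin (T + 1) → State m → ℝ} (hf : ∀ s z, 0 ≤ f s z)
    {H : ℝ} (hH : 0 < H) {t w : ℕ} (htw : t + 1 + w ≤ T) {n : ℕ} (hn : 0 < n)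
    (x : Fin n → PathSpace m T) {ε : ℝ} {a a₁ b : Fin (T + 1)} (ha : (a : ℕ) = t)
    (ha₁ : (a₁ : ℕ) = t + 1) (hb : (b : ℕ) = t + 1 + w) {ι : Type*}
    (h : ι → Fin (T + 1) → State m → ℝ) (p : ι → State m → ℝ) (Q : Finset (ι × ι))
    (hQ : Q.Nonempty) (C : Set ι) (hQC : ∀ q ∈ Q, q.1 ∈ C ∧ q.2 ∈ C)
    (hh : ∀ i ∈ C, ∀ s z, |h i s z| ≤ H) (hp : ∀ i ∈ C, ∀ z, |p i z| ≤ H)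
    (hcash : ∀ i ∈ C, ∀ y, cashFlow f (h i) (t + 1) w htw y ≤ H)
    (hsep : ∀ q ∈ Q, ε < empMean x fun y =>
      |centeredLoss f (h q.1) t w htw (p q.1) y - centeredLoss f (h q.2) t w htw (p q.2) y|) :
    ∃ E : Finset (Option (Fin (T + 1)) × State m × ℝ), E.card ≤ w + 1 ∧
      (∀ z ∈ E, z.1 ∈ insert none (insert (some a) ((Finset.Icc a₁ b).image some))) ∧
      ∃ R ⊆ Q, (∀ q ∈ R, ∃ z ∈ E, ¬ (z.2.2 < z.1.elim (p q.1) (h q.1) z.2.1 ↔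
        z.2.2 < z.1.elim (p q.2) (h q.2) z.2.1)) ∧ ε / (20 * H ^ 2) * Q.card ≤ R.card := by
  classical
  by_contra hne
  set κ : ℝ := ε / (20 * H ^ 2) * Q.card with hκ
  have hcon : ∀ E : Finset (Option (Fin (T + 1)) × State m × ℝ), E.card ≤ w + 1 →
      (∀ z ∈ E, z.1 ∈ insert none (insert (some a) ((Finset.Icc a₁ b).image some))) →
      ∀ R ⊆ Q, (∀ q ∈ R, ∃ z ∈ E, ¬ (z.2.2 < z.1.elim (p q.1) (h q.1) z.2.1 ↔
        z.2.2 < z.1.elim (p q.2) (h q.2) z.2.1)) → (R.card : ℝ) ≤ κ := fun E h1 h2 R h3 h4 =>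
    (not_le.1 fun h5 => hne ⟨E, h1, h2, R, h3, h4, h5⟩).le
  set v : ι → PathSpace m T → ℝ := fun i => cashFlow f (h i) (t + 1) w htw with hv
  have hsum_h : ∀ y : PathSpace m T,
      ∑ q ∈ Q, |h q.1 a (y a) - h q.2 a (y a)| ≤ κ * (H - -H) := by
    intro y
    refine sum_abs_sub_le_of_separated_le Q _ _ (by linarith)
      (fun q hq => abs_le.1 (hh _ (hQC q hq).1 _ _)) (fun q hq => abs_le.1 (hh _ (hQC q hq).2 _ _))
      fun u R hR hsepR => ?_
    exact hcon {(some a, y a, u)} (by simp) (by simp) R hR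
      fun q hq => ⟨_, Finset.mem_singleton_self _, hsepR q hq⟩
  have hsum_p : ∀ y : PathSpace m T, ∑ q ∈ Q, |p q.1 (y a) - p q.2 (y a)| ≤ κ * (H - -H) := by
    intro y
    refine sum_abs_sub_le_of_separated_le Q _ _ (by linarith)
      (fun q hq => abs_le.1 (hp _ (hQC q hq).1 _)) (fun q hq => abs_le.1 (hp _ (hQC q hq).2 _))
      fun u R hR hsepR => ?_
    exact hcon {(none, y a, u)} (by simp) (by simp) R hR
      fun q hq => ⟨_, Finset.mem_singleton_self _, hsepR q hq⟩
  have hab : a₁ ≤ b := Fin.le_def.2 (by omega)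
  have hsum_v : ∀ y : PathSpace m T, ∑ q ∈ Q, |v q.1 y - v q.2 y| ≤ κ * (H - 0) := by
    intro y
    refine sum_abs_sub_le_of_separated_le Q _ _ hH.le
      (fun q hq => ⟨cashFlow_nonneg hf _ _ _ _, hcash _ (hQC q hq).1 _⟩)
      (fun q hq => ⟨cashFlow_nonneg hf _ _ _ _, hcash _ (hQC q hq).2 _⟩)
      fun u R hR hsepR => ?_
    -- The test for a cash flow at level `u`: compare `h s` with `f s` at the `w` times before `b`,
    -- and `h b` with `u`.
    refine hcon (insert (some b, y b, u)
      ((Finset.Ico a₁ b).image fun s => (some s, y s, f s (y s)))) ?_ ?_ R hR ?_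
    · refine (Finset.card_insert_le _ _).trans (Nat.succ_le_succ ?_)
      refine Finset.card_image_le.trans ?_
      rw [Fin.card_Ico]
      omega
    · intro z hz
      simp only [Finset.mem_insert, Finset.mem_image] at hz ⊢
      rcases hz with rfl | ⟨s, hs, rfl⟩
      · exact Or.inr (Or.inr ⟨b, Finset.right_mem_Icc.2 hab, rfl⟩)
      · exact Or.inr (Or.inr ⟨s, Finset.Ico_subset_Icc_self hs, rfl⟩)
    · intro q hq
      by_contra hall
      refine hsepR q hq (lt_cashFlow_congr ha₁ hb (fun s hs => ?_) ?_)
      · exact not_not.1 fun hs' => hall ⟨(some s, y s, f s (y s)), Finset.mem_insert_of_mem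
          (Finset.mem_image_of_mem (fun s => (some s, y s, f s (y s))) hs), hs'⟩
      · exact not_not.1 fun hb' => hall ⟨(some b, y b, u), Finset.mem_insert_self _ _, hb'⟩
  have hloss : ∀ y : PathSpace m T, ∑ q ∈ Q, |centeredLoss f (h q.1) t w htw (p q.1) y -
      centeredLoss f (h q.2) t w htw (p q.2) y| ≤ ε * Q.card := by
    intro y
    have haeq : (⟨t, by omega⟩ : Fin (T + 1)) = a := Fin.ext ha.symm
    calc _ ≤ ∑ q ∈ Q, 4 * H * (|h q.1 a (y a) - h q.2 a (y a)| + |p q.1 (y a) - p q.2 (y a)| +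
          |v q.1 y - v q.2 y|) := by
          refine Finset.sum_le_sum fun q hq => ?_
          obtain ⟨h1, h2⟩ := hQC q hq
          simp only [centeredLoss, haeq]
          exact abs_centeredLoss_diff_le (hh _ h1 _ _) (hh _ h2 _ _) (hp _ h1 _) (hp _ h2 _)
            (cashFlow_nonneg hf _ _ _ _) (hcash _ h1 _)
      -- The ranges have lengths `2H`, `2H` and `H`, whence `20 H² = 4H * 5H`.
      _ ≤ 4 * H * (κ * (H - -H) + κ * (H - -H) + κ * (H - 0)) := by
          rw [← Finset.mul_sum, Finset.sum_add_distrib, Finset.sum_add_distrib]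
          have := hsum_h y
          have := hsum_p y
          have := hsum_v y
          gcongr
      _ = ε * Q.card := by
          rw [hκ]
          field_simp
          ring
  have hlt := Finset.sum_lt_sum_of_nonempty hQ hsep
  have hle : ∑ q ∈ Q, empMean x (fun y => |centeredLoss f (h q.1) t w htw (p q.1) y -
      centeredLoss f (h q.2) t w htw (p q.2) y|) ≤ ε * Q.card := by
    refine le_trans (le_of_eq ?_) (empMean_le hn x hloss)
    simp only [empMean]
    rw [← Finset.mul_sum, Finset.sum_comm]
  rw [Finset.sum_const, nsmul_eq_mul, mul_comm] at hlt
  exact absurd hle hlt.not_ge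

/-- After `N` greedy tests fewer than one of the `M * M - M` ordered pairs is left, hence none. -/
theorem one_sub_pow_mul_lt_one {M δ : ℝ} {N : ℕ} (hM1 : 1 < M) (hδ1 : δ ≤ 1)
    (hN : 2 * Real.log M ≤ δ * N) : (1 - δ) ^ N * (M * M - M) < 1 := by
  have hM0 : 0 < M := by linarith
  have h2 : (1 - δ) ^ N ≤ (M ^ 2)⁻¹ := by
    calc (1 - δ) ^ N ≤ Real.exp (-δ) ^ N :=
          pow_le_pow_left₀ (by linarith) (by linarith [Real.add_one_le_exp (-δ)]) N
      _ = Real.exp (-(δ * N)) := by rw [← Real.exp_nat_mul]; ring_nf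
      _ ≤ Real.exp (-(2 * Real.log M)) := Real.exp_le_exp.2 (by linarith)
      _ = (M ^ 2)⁻¹ := by
          rw [Real.exp_neg, mul_comm, Real.exp_mul, Real.exp_log hM0]
          norm_num
  refine (mul_le_mul_of_nonneg_right h2 (by nlinarith)).trans_lt ?_
  rw [← div_eq_inv_mul, div_lt_one (by positivity)]
  nlinarith

/-- Take logarithms, move `θ * log M` to the left and divide by `1 - θ`. -/
theorem le_exp_one_mul_rpow {M c θ r : ℝ} {D D' : ℕ} (hM0 : 0 < M) (hc0 : 0 < c) (hc1 : c ≤ 1)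
    (hD : D' ≤ D) (hθ1 : 0 < 1 - θ) (hM : M ≤ c⁻¹ ^ D' * Real.exp r)
    (hr : r ≤ θ * Real.log M + (1 - θ)) :
    M ≤ Real.exp 1 * c⁻¹ ^ ((D : ℝ) / (1 - θ)) := by
  have hcinv : 0 ≤ Real.log c⁻¹ := Real.log_nonneg (one_le_inv₀ hc0 |>.2 hc1)
  have hlog := Real.log_le_log hM0 hM
  rw [Real.log_mul (by positivity) (Real.exp_ne_zero _), Real.log_exp, Real.log_pow] at hlog
  have hD' : (D' : ℝ) * Real.log c⁻¹ ≤ D * Real.log c⁻¹ := by gcongr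
  rw [Real.rpow_def_of_pos (by positivity), ← Real.exp_add, ← Real.log_le_iff_le_exp hM0]
  calc Real.log M = (1 - θ) * Real.log M / (1 - θ) := by field_simp
    _ ≤ ((1 - θ) + D * Real.log c⁻¹) / (1 - θ) := by gcongr; linarith
    _ = _ := by field_simp

/-- A packing bound for centered losses. -/
theorem card_separated_centeredLoss_le {f : Fin (T + 1) → State m → ℝ} (hf : ∀ s z, 0 ≤ f s z)
    (𝓗 : Fin (T + 1) → Set (State m → ℝ)) {H : ℝ} (hH : 0 < H) {d : ℕ}
    (h𝓗_bdd : ∀ s, ∀ g ∈ 𝓗 s, ∀ z, |g z| ≤ H) (h𝓗_vc : ∀ s, vcDim (𝓗 s) ≤ d)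
    {t w : ℕ} (htw : t + 1 + w ≤ T) {n : ℕ} (hn : 0 < n)
    (x : Fin n → PathSpace m T) {ε : ℝ} (hε : 0 < ε) {a : Fin (T + 1)} (ha : (a : ℕ) = t)
    {ι : Type*} (h : ι → Fin (T + 1) → State m → ℝ) (p : ι → State m → ℝ) (C : Finset ι)
    (hh : ∀ i ∈ C, ∀ s, h i s ∈ 𝓗 s) (hp : ∀ i ∈ C, p i ∈ 𝓗 a)
    (hcash : ∀ i ∈ C, ∀ y, cashFlow f (h i) (t + 1) w htw y ≤ H)
    (hsep : ∀ i ∈ C, ∀ j ∈ C, i ≠ j → ε < empMean x fun y =>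
      |centeredLoss f (h i) t w htw (p i) y - centeredLoss f (h j) t w htw (p j) y|)
    (hC : 1 < C.card) {θ : ℝ} (hθ : 0 < θ) (hθ' : θ ≤ 1 / 2) :
    ε < 8 * H ^ 2 ∧ (C.card : ℝ) ≤ Real.exp 1 *
      (40 * (w + 1) * H ^ 2 / (ε * θ)) ^ (((w : ℝ) + 3) * d / (1 - θ)) := by
  classical
  have hεH : ε < 8 * H ^ 2 := by
    obtain ⟨i, hi, j, hj, hij⟩ := Finset.one_lt_card.1 hC
    refine (hsep i hi j hj hij).trans_le (empMean_le hn x fun y => ?_)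
    have key : ∀ i ∈ C, |centeredLoss f (h i) t w htw (p i) y| ≤ 4 * H ^ 2 := fun i hi => by
      have haeq : (⟨t, by omega⟩ : Fin (T + 1)) = a := Fin.ext ha.symm
      simp only [centeredLoss, haeq]
      exact abs_centeredLoss_le (h𝓗_bdd _ _ (hh i hi _) _) (h𝓗_bdd _ _ (hp i hi) _)
        (cashFlow_nonneg hf _ _ _ _) (hcash i hi _)
    have := abs_sub (centeredLoss f (h i) t w htw (p i) y) (centeredLoss f (h j) t w htw (p j) y)
    linarith [key i hi, key j hj]
  refine ⟨hεH, ?_⟩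
  set δ : ℝ := ε / (20 * H ^ 2) with hδ
  have hδ0 : 0 < δ := by positivity
  have hδ1 : δ ≤ 1 := by
    rw [hδ, div_le_one (by positivity)]
    nlinarith
  set M : ℝ := (C.card : ℝ) with hM
  have hM1 : 1 < M := by rw [hM]; exact_mod_cast hC
  have hM0 : 0 < M := by linarith
  have hlogM : 0 ≤ Real.log M := Real.log_nonneg hM1.le
  set N : ℕ := ⌈2 * Real.log M / δ⌉₊ with hN
  have hNge : 2 * Real.log M ≤ δ * N := by
    rw [mul_comm δ, ← div_le_iff₀ hδ0]
    exact Nat.le_ceil _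
  have hNle : δ * N ≤ 2 * Real.log M + δ := by
    have := (Nat.ceil_lt_add_one (show 0 ≤ 2 * Real.log M / δ by positivity)).le
    rw [← hN] at this
    calc δ * N ≤ δ * (2 * Real.log M / δ + 1) := by gcongr
      _ = 2 * Real.log M + δ := by field_simp
  set a₁ : Fin (T + 1) := ⟨t + 1, by omega⟩
  set b : Fin (T + 1) := ⟨t + 1 + w, by omega⟩
  -- The component functions: `none` stands for `p`, `some a` for `h a`, and the `w + 1` times from
  -- `a₁` to `b` serve the cash flow.
  set J : Finset (Option (Fin (T + 1))) :=
    insert none (insert (some a) ((Finset.Icc a₁ b).image some)) with hJ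
  have hJcard : J.card ≤ w + 3 := by
    refine (Finset.card_insert_le _ _).trans (Nat.succ_le_succ ?_)
    refine (Finset.card_insert_le _ _).trans (Nat.succ_le_succ ?_)
    refine Finset.card_image_le.trans ?_
    rw [Fin.card_Icc]
    simp only [a₁, b]
    omega
  obtain ⟨S, hS, R, hR, hsepR, hRcard⟩ := exists_tests
    (τ := {E : Finset (Option (Fin (T + 1)) × State m × ℝ) // E.card ≤ w + 1 ∧ ∀ z ∈ E, z.1 ∈ J})
    (fun E q => ∃ z ∈ E.1, ¬ (z.2.2 < z.1.elim (p q.1) (h q.1) z.2.1 ↔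
        z.2.2 < z.1.elim (p q.2) (h q.2) z.2.1)) C.offDiag hδ1
    (fun Q hQC hQ => by
      obtain ⟨E, h1, h2, h3⟩ := exists_separating_points hf hH htw hn x ha (a₁ := a₁) (b := b)
        rfl rfl h p Q hQ C (fun q hq => by
          have := Finset.mem_offDiag.1 (hQC hq)
          exact ⟨this.1, this.2.1⟩)
        (fun i hi s => h𝓗_bdd _ _ (hh i hi s)) (fun i hi => h𝓗_bdd _ _ (hp i hi)) hcash
        (fun q hq => by
          have := Finset.mem_offDiag.1 (hQC hq)
          exact hsep _ this.1 _ this.2.1 this.2.2)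
      exact ⟨⟨E, h1, h2⟩, h3⟩) N
  have hR0 : R = ∅ := by
    rw [← Finset.card_eq_zero]
    by_contra hne
    have h1 : (1 : ℝ) ≤ R.card := by exact_mod_cast Nat.one_le_iff_ne_zero.2 hne
    have h3 : (C.offDiag.card : ℝ) = M * M - M := by
      rw [Finset.offDiag_card, Nat.cast_sub (Nat.le_mul_self _)]
      push_cast
      rfl
    rw [h3] at hRcard
    exact absurd (h1.trans hRcard) (one_sub_pow_mul_lt_one hM1 hδ1 hNge).not_ge
  set F : Finset (Option (Fin (T + 1)) × State m × ℝ) := S.biUnion Subtype.val with hF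
  have hFcard : F.card ≤ N * (w + 1) :=
    (Finset.card_biUnion_le_card_mul _ _ _ fun E _ => E.2.1).trans (Nat.mul_le_mul_right _ hS)
  have hw : (0 : ℝ) < w + 1 := by positivity
  -- Chosen so that `c * (w + 1) = δ * θ / 2`; since `δ * N` is at most `2 * log M + δ`, this yields
  -- `c * #F ≤ θ * log M + δ * θ / 2`.
  set c : ℝ := ε * θ / (40 * (w + 1) * H ^ 2) with hc
  have hc0 : 0 < c := by positivity
  have hcδ : c * (w + 1) = δ * (θ / 2) := by
    rw [hc, hδ]
    field_simp
    norm_num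
  have hc1 : c ≤ 1 := by
    have : c * 1 ≤ c * (w + 1) := by gcongr; linarith [(Nat.cast_nonneg w : (0 : ℝ) ≤ w)]
    nlinarith
  have hmain := card_le_of_subgraphs_separated (fun i (k : Option (Fin (T + 1))) => k.elim (p i) (h i))
    C F J (fun z hz => by
      obtain ⟨E, -, hE⟩ := Finset.mem_biUnion.1 hz
      exact E.2.2 z hE) (fun k => k.elim (𝓗 a) 𝓗)
    (fun i hi k => by
      cases k with
      | none => exact hp i hi
      | some s => exact hh i hi s) d
    (fun k => by cases k <;> exact h𝓗_vc _)
    (fun i hi j hj hij => by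
      obtain ⟨E, hE, z, hz, hz'⟩ :=
        hsepR (i, j) (Finset.mem_offDiag.2 ⟨hi, hj, hij⟩) (by simp [hR0])
      exact ⟨z, Finset.mem_biUnion.2 ⟨E, hE, hz⟩, hz'⟩) hc0 hc1
  have hJ' : J.card * d ≤ (w + 3) * d := Nat.mul_le_mul_right d hJcard
  have hcF : c * F.card ≤ θ * Real.log M + (1 - θ) := by
    have : (F.card : ℝ) ≤ N * (w + 1) := by exact_mod_cast hFcard
    calc c * F.card ≤ c * (N * (w + 1)) := by gcongr
      _ = (δ * N) * (θ / 2) := by rw [mul_comm (N : ℝ), ← mul_assoc, hcδ]; ring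
      _ ≤ (2 * Real.log M + δ) * (θ / 2) := by gcongr
      _ ≤ _ := by nlinarith
  have hcinv' : 40 * (w + 1) * H ^ 2 / (ε * θ) = c⁻¹ := by rw [hc, inv_div]
  rw [hcinv']
  have := le_exp_one_mul_rpow hM0 hc0 hc1 hJ' (by linarith) hmain hcF
  exact_mod_cast this

/-! ### Covering numbers and the stated constants. -/

/-- Covering numbers are bounded by the cardinalities of finite separated subsets. -/
theorem empCoveringNumber_le {S : Type*} {n : ℕ} (x : Fin n → S) {ε : ℝ} (U : Set (S → ℝ)) {B : ℝ}
    (hB : ∀ C : Finset (S → ℝ), ↑C ⊆ U →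
      (∀ g ∈ C, ∀ g' ∈ C, g ≠ g' → ε < empMean x fun y => |g y - g' y|) → (C.card : ℝ) ≤ B) :
    ((empCoveringNumber x ε U : ℕ∞) : ENNReal) ≤ ENNReal.ofReal B := by
  let _ := empPseudoMetric x
  have hB0 : 0 ≤ B := by simpa using hB ∅ (by simp) (by simp)
  have hfin : ∀ C : Finset (S → ℝ), ↑C ⊆ U → Metric.IsSeparated (ε.toNNReal : ℝ≥0∞) (C : Set (S → ℝ)) →
      C.card ≤ ⌊B⌋₊ := by
    refine fun C hC hsep => Nat.le_floor (hB C hC fun g hg g' hg' hne => ?_)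
    have : (ε.toNNReal : ℝ≥0∞) < edist g g' := hsep hg hg' hne
    rw [edist_dist] at this
    exact (ENNReal.ofReal_lt_ofReal_iff'.1 this).1
  have hpack : Metric.packingNumber ε.toNNReal U ≤ (⌊B⌋₊ : ℕ∞) := by
    refine iSup_le fun C => iSup_le fun hC => iSup_le fun hsep => ?_
    by_contra! hlt
    -- The packing number also ranges over infinite sets; a subset of exactly `⌊B⌋₊ + 1` points
    -- brings the finite bound into play.
    obtain ⟨D, hDC, hD⟩ := Set.exists_subset_encard_eq (Order.add_one_le_of_lt hlt)
    have hDfin : D.Finite := Set.finite_of_encard_eq_coe (k := ⌊B⌋₊ + 1) (by simpa using hD)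
    lift D to Finset (S → ℝ) using hDfin
    have := hfin D (hDC.trans hC) (hsep.subset hDC)
    rw [Set.encard_coe_eq_coe_finsetCard] at hD
    have : D.card = ⌊B⌋₊ + 1 := by exact_mod_cast hD
    omega
  have hcov : empCoveringNumber x ε U ≤ (⌊B⌋₊ : ℕ∞) :=
    ((Metric.externalCoveringNumber_le_coveringNumber _ _).trans
      (Metric.coveringNumber_le_packingNumber _ _)).trans hpack
  refine (ENat.toENNReal_le.2 hcov).trans ?_
  rw [ENat.toENNReal_coe, ← ENNReal.ofReal_natCast]
  exact ENNReal.ofReal_le_ofReal (Nat.floor_le hB0)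

/-- `((w + 1) X) ^ (2 (w + 3) d) ≤ X ^ (2 d (c(w) + 1))` for `X ≥ 2`. -/
theorem rpow_le_rpow_cConst {X : ℝ} (hX : 2 ≤ X) (w d : ℕ) :
    ((w + 1) * X) ^ (2 * ((w : ℝ) + 3) * d) ≤ X ^ (2 * (d : ℝ) * (cConst w + 1)) := by
  have hX0 : 0 < X := by linarith
  have hw : (0 : ℝ) ≤ w := Nat.cast_nonneg w
  set L := Real.logb 2 ((w : ℝ) + 2) with hL
  have hL0 : 0 ≤ L := Real.logb_nonneg (by norm_num) (by linarith)
  -- The logarithm in `cConst` pays for the factor `w + 1`: as `X ≥ 2`, it is at most a power `X ^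
  -- L`.
  have h1 : (w : ℝ) + 1 ≤ X ^ L := by
    calc (w : ℝ) + 1 ≤ w + 2 := by linarith
      _ = 2 ^ L := (Real.rpow_logb (by norm_num) (by norm_num) (by positivity)).symm
      _ ≤ X ^ L := Real.rpow_le_rpow (by norm_num) hX hL0
  have h2 : (w + 1) * X ≤ X ^ (L + 1) := by
    rw [Real.rpow_add_one hX0.ne']
    gcongr
  have hc : 2 * ((w : ℝ) + 2) * (1 + L) ≤ cConst w := by
    rw [cConst, Real.logb_mul (Real.exp_ne_zero 1) (by positivity)]
    have : 1 ≤ Real.logb 2 (Real.exp 1) := by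
      rw [Real.le_logb_iff_rpow_le (by norm_num) (Real.exp_pos 1)]
      linarith [Real.exp_one_gt_d9, Real.rpow_one (2 : ℝ)]
    gcongr
  calc _ ≤ (X ^ (L + 1)) ^ (2 * ((w : ℝ) + 3) * d) :=
        Real.rpow_le_rpow (by positivity) h2 (by positivity)
    _ = X ^ ((L + 1) * (2 * ((w : ℝ) + 3) * d)) := (Real.rpow_mul hX0.le _ _).symm
    _ ≤ _ := by
        refine Real.rpow_le_rpow_of_exponent_le (by linarith) ?_
        have : (L + 1) * (w + 3) ≤ cConst w + 1 := by nlinarith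
        calc (L + 1) * (2 * ((w : ℝ) + 3) * d) = 2 * d * ((L + 1) * (w + 3)) := by ring
          _ ≤ _ := by gcongr

end OptStop

theorem mainTheorem10 {m T : ℕ}
    (P : MeasureTheory.Measure (OptStop.PathSpace m T)) [MeasureTheory.IsProbabilityMeasure P]
    -- nonnegative payoff in `L₁(X)`
    (f : Fin (T + 1) → OptStop.State m → ℝ)
    (hf_int : ∀ s, MeasureTheory.MemLp (f s) 1 (OptStop.marginal P s))
    (hf_nonneg : ∀ s z, 0 ≤ f s z)
    -- approximation spaces: closed convex subsets of `L₂(μ_s)`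
    (𝓗 : Fin (T + 1) → Set (OptStop.State m → ℝ))
    (h𝓗_L2 : ∀ s, ∀ g ∈ 𝓗 s, MeasureTheory.MemLp g 2 (OptStop.marginal P s))
    (h𝓗_convex : ∀ s, Convex ℝ (OptStop.toL2 (OptStop.marginal P s) (𝓗 s)))
    (h𝓗_closed : ∀ s, IsClosed (OptStop.toL2 (OptStop.marginal P s) (𝓗 s)))
    -- uniformly bounded by `H`, with VC-dimension at most `d`
    (H : ℝ) (d : ℕ)
    (h𝓗_bdd : ∀ s, ∀ g ∈ 𝓗 s, ∀ z, |g z| ≤ H)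
    (h𝓗_vc : ∀ s, OptStop.vcDim (𝓗 s) ≤ (d : ℕ∞))
    -- `0 ≤ t` and `0 ≤ w ≤ T - t - 1`
    (t w : ℕ) (htw : t + 1 + w ≤ T)
    (h_cash : ∀ h ∈ OptStop.hypSpace f 𝓗, ∀ x, OptStop.cashFlow f h (t + 1) w htw x ≤ H)
    -- sample points and radius
    (n : ℕ) (hn : 0 < n) (x : Fin n → OptStop.PathSpace m T)
    (ε : ℝ) (hε : 0 < ε) (hεH : ε ≤ 64 * Real.exp 1 * H ^ 2) :
    (1 ≤ w →
      ((OptStop.empCoveringNumber x ε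
          (OptStop.centeredLossClass P f 𝓗 t w htw) : ℕ∞) : ENNReal) ≤
        ENNReal.ofReal (Real.exp 1 ^ 4 * ((d : ℝ) + 1) ^ 2 * (OptStop.cConst w * d + 1) ^ 2 *
          (64 * Real.exp 1 * H ^ 2 / ε) ^ (2 * (d : ℝ) * (OptStop.cConst w + 1)))) ∧
    (w = 0 →
      ((OptStop.empCoveringNumber x ε
          (OptStop.centeredLossClass P f 𝓗 t w htw) : ℕ∞) : ENNReal) ≤
        ENNReal.ofReal (Real.exp 1 ^ 4 * ((d : ℝ) + 1) ^ 4 *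
          (64 * Real.exp 1 * H ^ 2 / ε) ^ (4 * d))) := by
  classical
  set a : Fin (T + 1) := ⟨t, by omega⟩ with ha
  set X : ℝ := 64 * Real.exp 1 * H ^ 2 / ε with hXdef
  have he : (2.7 : ℝ) < Real.exp 1 := by linarith [Real.exp_one_gt_d9]
  have he1 : (1 : ℝ) ≤ Real.exp 1 := by linarith
  have hX1 : 1 ≤ X := by rwa [hXdef, one_le_div hε]
  have hd : (0 : ℝ) ≤ d := Nat.cast_nonneg d
  have hw : (0 : ℝ) ≤ w := Nat.cast_nonneg w
  -- The condition `2 ≤ X` costs nothing: two separated losses force `ε < 8 H²`, and a family of at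
  -- most one loss is covered by `1 ≤ B`.
  have key : ∀ {θ B : ℝ}, 0 < θ → θ ≤ 1 / 2 → 1 ≤ B →
      (2 ≤ X → Real.exp 1 * (40 * (w + 1) * H ^ 2 / (ε * θ)) ^ (((w : ℝ) + 3) * d / (1 - θ)) ≤ B) →
      ((OptStop.empCoveringNumber x ε (OptStop.centeredLossClass P f 𝓗 t w htw) : ℕ∞) : ENNReal) ≤
        ENNReal.ofReal B := by
    intro θ B hθ hθ' hB1 hB
    refine OptStop.empCoveringNumber_le x _ fun C hC hsep => ?_
    rcases le_or_gt C.card 1 with hC1 | hC1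
    · exact (Nat.cast_le_one.2 hC1).trans hB1
    have hC' : ∀ l ∈ C, ∃ h ∈ OptStop.hypSpace f 𝓗, ∃ p ∈ 𝓗 a,
        l = OptStop.centeredLoss f h t w htw p := fun l hl => by
      obtain ⟨h, hh, p, hp, e⟩ := hC hl
      exact ⟨h, hh, p, hp.1, e⟩
    choose! h hh p hp e using hC'
    have hH : 0 < H := by
      obtain ⟨l, hl⟩ := Finset.card_pos.1 (zero_lt_one.trans hC1)
      refine lt_of_le_of_ne ((abs_nonneg _).trans (h𝓗_bdd a _ (hp l hl) 0)) ?_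
      rintro rfl
      norm_num at hεH
      linarith
    obtain ⟨h8, hcard⟩ := OptStop.card_separated_centeredLoss_le hf_nonneg 𝓗 hH h𝓗_bdd h𝓗_vc htw
      hn x hε (a := a) rfl h p C (fun l hl => (hh l hl).1) hp (fun l hl => h_cash _ (hh l hl))
      (fun l hl l' hl' hne => by rw [← e l hl, ← e l' hl']; exact hsep l hl l' hl' hne) hC1 hθ hθ'
    refine hcard.trans (hB ?_)
    rw [hXdef, le_div_iff₀ hε]
    nlinarith [sq_nonneg H]
  have hH2 : 0 ≤ H ^ 2 / ε := by positivity
  have hXH : X = 64 * Real.exp 1 * (H ^ 2 / ε) := by rw [hXdef]; ring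
  have he4' : Real.exp 1 ≤ Real.exp 1 ^ 4 := le_self_pow₀ he1 (by norm_num)
  refine ⟨fun _ => ?_, fun hw0 => ?_⟩
  · have hc : 0 ≤ OptStop.cConst w :=
      mul_nonneg (by positivity) (Real.logb_nonneg (by norm_num) (by nlinarith))
    have hpre : Real.exp 1 ≤
        Real.exp 1 ^ 4 * ((d : ℝ) + 1) ^ 2 * (OptStop.cConst w * d + 1) ^ 2 := by
      have h1 : 1 ≤ ((d : ℝ) + 1) ^ 2 := one_le_pow₀ (by linarith)
      have h2 : 1 ≤ (OptStop.cConst w * d + 1) ^ 2 :=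
        one_le_pow₀ (by linarith [mul_nonneg hc hd])
      exact he4'.trans ((le_mul_of_one_le_right (by positivity) h1).trans
        (le_mul_of_one_le_right (by positivity) h2))
    -- This `θ` gives the exponent `2 (w + 3) d` and the base `80 (w + 1) H² / ε`, where `80 ≤ 64
    -- e`.
    refine key (θ := 1 / 2) (by norm_num) le_rfl ?_ fun hX2 => ?_
    · exact one_le_mul_of_one_le_of_one_le (he1.trans hpre)
        (Real.one_le_rpow hX1 (by positivity))
    · refine mul_le_mul hpre (le_trans ?_ (OptStop.rpow_le_rpow_cConst hX2 w d)) (by positivity)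
        (by positivity)
      have h1 : 40 * ((w : ℝ) + 1) * H ^ 2 / (ε * (1 / 2)) = (w + 1) * (80 * (H ^ 2 / ε)) := by
        field_simp
        ring
      have h2 : ((w : ℝ) + 3) * d / (1 - 1 / 2) = 2 * (w + 3) * d := by ring
      rw [h1, h2, hXH]
      gcongr
      linarith
  · subst hw0
    have hpre : Real.exp 1 ≤ Real.exp 1 ^ 4 * ((d : ℝ) + 1) ^ 4 :=
      he4'.trans (le_mul_of_one_le_right (by positivity) (one_le_pow₀ (by linarith)))
    -- With `w = 0` the exponent `3 d / (1 - θ)` must equal `4 d`, which fixes `θ = 1 / 4`; the base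
    -- is `160 H² / ε`, and `160 ≤ 64 e`.
    refine key (θ := 1 / 4) (by norm_num) (by norm_num) ?_ fun _ => ?_
    · exact one_le_mul_of_one_le_of_one_le (he1.trans hpre) (one_le_pow₀ hX1)
    · refine mul_le_mul hpre ?_ (by positivity) (by positivity)
      have h1 : 40 * (((0 : ℕ) : ℝ) + 1) * H ^ 2 / (ε * (1 / 4)) = 160 * (H ^ 2 / ε) := by
        field_simp
        ring
      have h2 : (((0 : ℕ) : ℝ) + 3) * d / (1 - 1 / 4) = ((4 * d : ℕ) : ℝ) := by
        push_cast
        ring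
      rw [h1, h2, Real.rpow_natCast, hXH]
      gcongr
      linarith
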